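/- Let $A$ (actions) and $\Omega$ (states) be non-empty finite sets, and let $u, v : A\times\Omega\to\mathbb{R}$ be the payoff functions of the experts and of the decision-maker. Let $\Delta(A)$ and $\Delta(\Omega)$ denote the sets of probability distributions on $A$ and $\Omega$. For $\alpha\in\Delta(A)$ and $\pi\in\Delta(\Omega)$ write $u(\alpha,\pi)=\sum_{a,\omega}\alpha(a)\pi(\omega)u(a,\omega)$, and similarly $v(\alpha,\pi)$. Let $$BR(\pi)=\{\alpha\in\Delta(A): v(\alpha,\pi)\ge v(\alpha',\pi)\ \text{for all } \alpha'\in\Delta(A)\},\qquad \overline{u}(\pi)=\max_{\alpha\in BR(\pi)}u(\alpha,\pi),$$ and let $\mathrm{cav}\,\overline{u}$ be the concavification of $\overline{u}$, that is, the smallest concave function on $\Delta(\Omega)$ that is everywhere at least $\overline{u}$. **Lemma 1 (Uniform punishment).** Let $\pi^\circ\in\Delta(\Omega)$ be a prior and let $(\lambda^*_s,\pi^*_s)_{s\in S}$, with $S$ finite, be an optimal splitting of $\pi^\circ$; that is, $\lambda^*_s>0$ and $\pi^*_s\in\Delta(\Omega)$ for every $s\in S$, $\sum_{s}\lambda^*_s=1$,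 $\sum_{s}\lambda^*_s\pi^*_s=\pi^\circ$, and $\sum_{s}\lambda^*_s\,\overline{u}(\pi^*_s)=\mathrm{cav}\,\overline{u}(\pi^\circ)$. Then there exist a belief $\pi_p$ in the convex hull of $\{\pi^*_s : s\in S\}$ and a mixed action $\alpha_p\in BR(\pi_p)$ such that $u(\alpha_p,\pi^*_s)\le\overline{u}(\pi^*_s)$ for every $s\in S$. -/

import Mathlib

open scoped BigOperators

namespace UniformPunishment

noncomputable section

/-- The expected payoff `w(α, π)` of a player with payoff function `w`, when the decision-maker
plays the mixed action `α` and the state is distributed according to the belief `π`. -/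
def payoff {A Ω : Type*} [Fintype A] [Fintype Ω] (w : A → Ω → ℝ) (α : A → ℝ) (π : Ω → ℝ) : ℝ :=
  ∑ a, ∑ ω, α a * π ω * w a ω

/-- The set `BR(π)` of mixed best replies at the belief `π` of a decision-maker with payoff `v`. -/
def BR {A Ω : Type*} [Fintype A] [Fintype Ω] (v : A → Ω → ℝ) (π : Ω → ℝ) : Set (A → ℝ) :=
  {α | α ∈ stdSimplex ℝ A ∧ ∀ α' ∈ stdSimplex ℝ A, payoff v α' π ≤ payoff v α π}

/-- `ū(π)`, the maximum of `u(α, π)` over the best replies `α ∈ BR(π)`. (For a non-empty finite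
set of actions, `BR(π)` is non-empty and compact, so that the supremum is attained.) -/
def ubar {A Ω : Type*} [Fintype A] [Fintype Ω] (u v : A → Ω → ℝ) (π : Ω → ℝ) : ℝ :=
  sSup ((fun α => payoff u α π) '' BR v π)

/-- The concavification `cav g` of a function `g` on the simplex `Δ(Ω)`: the pointwise infimum of
the concave functions on `Δ(Ω)` that lie above `g`, i.e. the least concave majorant of `g`. -/
def cav {Ω : Type*} [Fintype Ω] (g : (Ω → ℝ) → ℝ) (π : Ω → ℝ) : ℝ :=
  sInf {r | ∃ f : (Ω → ℝ) → ℝ, ConcaveOn ℝ (stdSimplex ℝ Ω) f ∧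
    (∀ p ∈ stdSimplex ℝ Ω, g p ≤ f p) ∧ f π = r}

/-- `(l s, q s)`, `s ∈ S`, is an optimal splitting of the prior `π₀`: the signals `s` have positive
probabilities `l s` that add up to one, the posteriors `q s` average to the prior, and the
expected value of `ū` at the posteriors is `cav ū (π₀)`. -/
structure IsOptimalSplitting {A Ω S : Type*} [Fintype A] [Fintype Ω] [Fintype S]
    (u v : A → Ω → ℝ) (π₀ : Ω → ℝ) (l : S → ℝ) (q : S → Ω → ℝ) : Prop where
  weight_pos : ∀ s, 0 < l s
  weight_sum : ∑ s, l s = 1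
  posterior_mem : ∀ s, q s ∈ stdSimplex ℝ Ω
  average : ∑ s, l s • q s = π₀
  optimal : ∑ s, l s * ubar u v (q s) = cav (ubar u v) π₀

end

end UniformPunishment

/-!
Consider the two-player game in which an adversary picks a signal `s`, the decision-maker picks an
action `a`, the decision-maker is paid `v(a, q s)` and the adversary is paid
`u(a, q s) - ū(q s)`. Let `(x, α)` be a Nash equilibrium of it (`exists_equilibrium`), and put
`πp = ∑ s, x s • q s`. As payoffs are linear in beliefs, `α` is a best reply at `πp`, so that
`u(α, πp) ≤ ū(πp)`. Optimality of the splitting, together with the positivity of its weights, gives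
`ū(πp) ≤ ∑ s, x s * ū(q s)` (`IsOptimalSplitting.ubar_sum_le`). Hence the equilibrium payoff of the
adversary is at most zero. But it is the maximum over `s` of `u(α, q s) - ū(q s)`, so every one of
these differences is at most zero.

Existence of equilibria is derived from a combinatorial lemma of Scarf
(`exists_dominant_colorful`), which plays the role of Sperner's lemma without triangulations. For a
continuous field `y` on the simplex, colour each point of a fine grid by a coordinate at which `y`
is maximal. The lemma yields nearby grid points of all colours, except for those whose coordinates
almost vanish, and in the limit a point `x` supported on the maximal coordinates of `y x`
(`exists_support_subset_argmax`). Applied to the payoffs of one player against a continuous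
`ε`-best reply of the other, this gives approximate equilibria, and equilibria as `ε → 0`.
-/

namespace UniformPunishment

/-! ### A parity lemma of Scarf -/

/-- A finite set `E` is dominant for the rankings `r i`, `i ∈ I`, if no point is ranked strictly
above the `r i`-minimum of `E` for all `i` at once. -/
def Dominant {I X : Type*} (r : I → X → ℕ) (E : Finset X) : Prop :=
  ∀ y, ∃ i, ∀ x ∈ E, r i y ≤ r i x

lemma Dominant.mono {I X : Type*} {r : I → X → ℕ} {E F : Finset X} (hE : Dominant r E)
    (h : F ⊆ E) : Dominant r F := fun y =>
  (hE y).imp fun _ hi x hx => hi x (h hx)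

section Scarf

variable {I X : Type*} {r : I → X → ℕ}

open Classical in
/-- The rooms of the parity argument: the dominant sets with as many points as rankings. -/
noncomputable def rooms [Fintype I] [Fintype X] (r : I → X → ℕ) : Finset (Finset X) :=
  {E | E.card = Fintype.card I ∧ Dominant r E}

open Classical in
/-- The doors of the parity argument: the dominant sets with one point less than there are
rankings, in which exactly the colours other than `i₀` occur. -/
noncomputable def doors [Fintype I] [DecidableEq I]
    [Fintype X] [DecidableEq X] (r : I → X → ℕ) (c : X → I) (i₀ : I) : Finset (Finset X) :=
  {F | F.card + 1 = Fintype.card I ∧ Dominant r F ∧ F.image c = Finset.univ.erase i₀}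

lemma mem_rooms [Fintype I] [Fintype X] {E : Finset X} :
    E ∈ rooms r ↔ E.card = Fintype.card I ∧ Dominant r E := by
  simp [rooms]

lemma mem_doors [Fintype I] [DecidableEq I] [Fintype X] [DecidableEq X] {c : X → I} {i₀ : I}
    {F : Finset X} : F ∈ doors r c i₀ ↔
      F.card + 1 = Fintype.card I ∧ Dominant r F ∧ F.image c = Finset.univ.erase i₀ := by
  simp [doors]

/-- `p` selects, for each `i`, the point of `F` that is minimal for the ranking `r i`. -/
def IsMinSelection (r : I → X → ℕ) (F : Finset X) (p : I → X) : Prop :=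
  ∀ i, p i ∈ F ∧ ∀ x ∈ F, r i (p i) ≤ r i x

lemma exists_isMinSelection (r : I → X → ℕ) {F : Finset X} (hF : F.Nonempty) :
    ∃ p, IsMinSelection r F p := by
  choose p hp using fun i => F.exists_min_image (r i) hF
  exact ⟨p, hp⟩

/-- The points ranked strictly above the minimum of `F` by every ranking except possibly `r k`.
The `r k`-maximum of this set is what replaces the point that `k` selected. -/
def Above (r : I → X → ℕ) (p : I → X) (k : I) : Set X :=
  {y | ∀ l, l ≠ k → r l (p l) < r l y}

lemma IsMinSelection.exists_eq (hr : ∀ i, Function.Injective (r i)) {F : Finset X} {p : I → X}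
    (hp : IsMinSelection r F p) (hF : Dominant r F) {x : X} (hx : x ∈ F) : ∃ i, p i = x := by
  obtain ⟨i, hi⟩ := hF x
  exact ⟨i, hr i (le_antisymm ((hp i).2 x hx) (hi _ (hp i).1))⟩

lemma exists_max_above [Finite X] (r : I → X → ℕ) (p : I → X) (k : I)
    (h : (Above r p k).Nonempty) :
    ∃ x ∈ Above r p k, ∀ y ∈ Above r p k, r k y ≤ r k x :=
  Set.exists_max_image _ (r k) (Set.toFinite _) h

lemma IsMinSelection.exists_collision [Fintype I] {F : Finset X} {p : I → X}
    (hp : IsMinSelection r F p) (hcard : F.card + 1 = Fintype.card I) :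
    ∃ i j, i ≠ j ∧ p i = p j := by
  obtain ⟨i, -, j, -, hij, h⟩ := Finset.exists_ne_map_eq_of_card_lt_of_maps_to
    (s := (Finset.univ : Finset I)) (t := F) (f := p)
    (by rw [Finset.card_univ]; omega) (fun i _ => (hp i).1)
  exact ⟨i, j, hij, h⟩

variable [Fintype I] [DecidableEq I] [DecidableEq X]

/-- The minima of `F` exhaust it, so if `i` and `j` share a minimum, then for reasons of cardinality
no two rankings other than `j` do. -/
lemma IsMinSelection.injOn_of_eq (hr : ∀ i, Function.Injective (r i)) {F : Finset X} {p : I → X}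
    (hp : IsMinSelection r F p) (hF : Dominant r F) (hcard : F.card + 1 = Fintype.card I)
    {i j : I} (hij : i ≠ j) (h : p i = p j) :
    Set.InjOn p (Finset.univ.erase j : Finset I) := by
  have him : (Finset.univ.erase j).image p = F := by
    ext x
    simp only [Finset.mem_image, Finset.mem_erase, Finset.mem_univ, and_true]
    constructor
    · rintro ⟨k, -, rfl⟩
      exact (hp k).1
    · intro hx
      obtain ⟨k, rfl⟩ := hp.exists_eq hr hF hx
      by_cases hk : k = j
      · exact ⟨i, hij, by rw [h, hk]⟩
      · exact ⟨k, hk, rfl⟩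
  apply Finset.card_image_iff.1
  rw [him, Finset.card_erase_of_mem (Finset.mem_univ j), Finset.card_univ]
  omega

lemma IsMinSelection.eq_or_eq_of_collision (hr : ∀ i, Function.Injective (r i)) {F : Finset X}
    {p : I → X} (hp : IsMinSelection r F p) (hF : Dominant r F)
    (hcard : F.card + 1 = Fintype.card I) {i j : I} (hij : i ≠ j) (h : p i = p j)
    {k l : I} (hkl : k ≠ l) (h' : p k = p l) : k = i ∨ k = j := by
  have hj := hp.injOn_of_eq hr hF hcard hij h
  by_contra! hk
  by_cases hl : l = j
  · exact hk.1 (hj (by simpa using hk.2) (by simpa using hij) (by rw [h', hl, h]))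
  · exact hkl (hj (by simpa using hk.2) (by simpa using hl) h')

/-- Adding a point outside `F` keeps dominance exactly when the point is the `r k`-maximum of
`Above r p k`, for one of the two `k` whose minimum is shared. -/
lemma IsMinSelection.dominant_insert_iff (hr : ∀ i, Function.Injective (r i)) {F : Finset X}
    {p : I → X} (hp : IsMinSelection r F p) (hF : Dominant r F)
    (hcard : F.card + 1 = Fintype.card I) {i j : I} (hij : i ≠ j) (h : p i = p j) (x : X) :
    (x ∉ F ∧ Dominant r (insert x F)) ↔
      ∃ k, (k = i ∨ k = j) ∧ x ∈ Above r p k ∧ ∀ y ∈ Above r p k, r k y ≤ r k x := by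
  constructor
  · rintro ⟨hx, hE⟩
    obtain ⟨k, hk⟩ := hE x
    -- Every point of `F` is still the minimum of `insert x F` for some ranking other than `k`.
    have hmin : ∀ z ∈ F, ∃ m, m ≠ k ∧ p m = z ∧ r m z < r m x := by
      intro z hz
      obtain ⟨m, hm⟩ := hE z
      have hzx : z ≠ x := fun e => hx (e ▸ hz)
      have h1 : r m z < r m x :=
        lt_of_le_of_ne (hm x (Finset.mem_insert_self _ _)) fun e => hzx (hr m e)
      refine ⟨m, ?_, ?_, h1⟩
      · rintro rfl
        exact absurd (hk z (Finset.mem_insert_of_mem hz)) (not_le.2 h1)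
      · exact hr m (le_antisymm ((hp m).2 z hz) (hm _ (Finset.mem_insert_of_mem (hp m).1)))
    obtain ⟨l, hlk, hl, -⟩ := hmin (p k) (hp k).1
    have hinj := hp.injOn_of_eq hr hF hcard hlk hl
    refine ⟨k, hp.eq_or_eq_of_collision hr hF hcard hij h hlk.symm hl.symm, ?_, ?_⟩
    · intro l' hl'
      obtain ⟨m, hmk, hm, hlt⟩ := hmin (p l') (hp l').1
      have : m = l' := hinj (by simpa using hmk) (by simpa using hl') hm
      exact this ▸ hlt
    · intro y hy
      obtain ⟨m, hm⟩ := hE y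
      have : m = k := by
        by_contra hmk
        exact absurd (hm _ (Finset.mem_insert_of_mem (hp m).1)) (not_le.2 (hy m hmk))
      exact this ▸ hm x (Finset.mem_insert_self _ _)
  · rintro ⟨k, hk, hxA, hmax⟩
    obtain ⟨l, hlk, hl⟩ : ∃ l, l ≠ k ∧ p l = p k := by
      rcases hk with rfl | rfl
      · exact ⟨j, hij.symm, h.symm⟩
      · exact ⟨i, hij, h⟩
    refine ⟨fun hx => ?_, fun y => ?_⟩
    · obtain ⟨m, rfl⟩ := hp.exists_eq hr hF hx
      by_cases hmk : m = k
      · have := hxA l hlk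
        rw [hl, hmk] at this
        exact lt_irrefl _ this
      · exact lt_irrefl _ (hxA m hmk)
    · by_cases hy : y ∈ Above r p k
      · refine ⟨k, fun z hz => ?_⟩
        rcases Finset.mem_insert.1 hz with rfl | hz
        · exact hmax y hy
        · obtain ⟨m, hm⟩ := hF y
          have : m = k := by
            by_contra hmk
            exact absurd (hm _ (hp m).1) (not_le.2 (hy m hmk))
          exact this ▸ hm z hz
      · simp only [Above, Set.mem_ofPred_eq, not_forall, not_lt] at hy
        obtain ⟨m, hmk, hm⟩ := hy
        refine ⟨m, fun z hz => ?_⟩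
        rcases Finset.mem_insert.1 hz with rfl | hz
        · exact hm.trans (hxA m hmk).le
        · exact hm.trans ((hp m).2 z hz)

variable [Fintype X]

/-- The rooms that contain a given dominant set `F` with one point less. -/
lemma IsMinSelection.mem_rooms_iff (hr : ∀ i, Function.Injective (r i)) {F : Finset X}
    {p : I → X} (hp : IsMinSelection r F p) (hF : Dominant r F)
    (hcard : F.card + 1 = Fintype.card I) {i j : I} (hij : i ≠ j) (h : p i = p j)
    (E : Finset X) :
    (E ∈ rooms r ∧ F ⊆ E) ↔ ∃ x, E = insert x F ∧ ∃ k, (k = i ∨ k = j) ∧ x ∈ Above r p k ∧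
      ∀ y ∈ Above r p k, r k y ≤ r k x := by
  simp_rw [← hp.dominant_insert_iff hr hF hcard hij h, mem_rooms]
  constructor
  · rintro ⟨⟨hE, hdom⟩, hsub⟩
    obtain ⟨x, hx, rfl⟩ := (Finset.covBy_iff_exists_insert (s := F) (t := E)).1
      (Finset.covBy_iff_card_sdiff_eq_one.2 ⟨hsub, by
        rw [Finset.card_sdiff_of_subset hsub]; omega⟩)
    exact ⟨x, rfl, hx, hdom⟩
  · rintro ⟨x, rfl, hx, hdom⟩
    exact ⟨⟨by rw [Finset.card_insert_of_notMem hx, hcard], hdom⟩, Finset.subset_insert _ _⟩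

open Classical in
/-- If both sets of candidate replacements are non-empty, exactly two rooms contain `F`. -/
lemma IsMinSelection.card_rooms_eq_two (hr : ∀ i, Function.Injective (r i)) {F : Finset X}
    {p : I → X} (hp : IsMinSelection r F p) (hF : Dominant r F)
    (hcard : F.card + 1 = Fintype.card I) {i j : I} (hij : i ≠ j) (h : p i = p j)
    (hi : (Above r p i).Nonempty) (hj : (Above r p j).Nonempty) :
    ((rooms r).filter (F ⊆ ·)).card = 2 := by
  obtain ⟨x, hx, hxm⟩ := exists_max_above r p i hi
  obtain ⟨y, hy, hym⟩ := exists_max_above r p j hj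
  have hxy : x ≠ y := by
    rintro rfl
    obtain ⟨m, hm⟩ := hF x
    by_cases hmi : m = i
    · exact absurd (hm _ (hp m).1) (not_le.2 (hy m (hmi ▸ hij)))
    · exact absurd (hm _ (hp m).1) (not_le.2 (hx m hmi))
  have hxF := ((hp.dominant_insert_iff hr hF hcard hij h x).2 ⟨i, .inl rfl, hx, hxm⟩).1
  have : (rooms r).filter (F ⊆ ·) = {insert x F, insert y F} := by
    ext E
    rw [Finset.mem_filter, hp.mem_rooms_iff hr hF hcard hij h, Finset.mem_insert,
      Finset.mem_singleton]
    constructor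
    · rintro ⟨z, rfl, k, rfl | rfl, hz, hzm⟩
      · rw [hr k (le_antisymm (hxm z hz) (hzm x hx))]; exact .inl rfl
      · rw [hr k (le_antisymm (hym z hz) (hzm y hy))]; exact .inr rfl
    · rintro (rfl | rfl)
      · exact ⟨x, rfl, i, .inl rfl, hx, hxm⟩
      · exact ⟨y, rfl, j, .inr rfl, hy, hym⟩
  rw [this, Finset.card_pair]
  intro e
  have : x ∈ insert y F := e ▸ Finset.mem_insert_self x F
  rcases Finset.mem_insert.1 this with h' | h'
  exacts [hxy h', hxF h']

open Classical in
lemma IsMinSelection.card_rooms_eq_one (hr : ∀ i, Function.Injective (r i)) {F : Finset X}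
    {p : I → X} (hp : IsMinSelection r F p) (hF : Dominant r F)
    (hcard : F.card + 1 = Fintype.card I) {i j : I} (hij : i ≠ j) (h : p i = p j)
    (hi : (Above r p i).Nonempty) (hj : ¬ (Above r p j).Nonempty) :
    ((rooms r).filter (F ⊆ ·)).card = 1 := by
  obtain ⟨x, hx, hxm⟩ := exists_max_above r p i hi
  refine Finset.card_eq_one.2 ⟨insert x F, ?_⟩
  ext E
  rw [Finset.mem_filter, hp.mem_rooms_iff hr hF hcard hij h, Finset.mem_singleton]
  constructor
  · rintro ⟨z, rfl, k, rfl | rfl, hz, hzm⟩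
    · rw [hr k (le_antisymm (hxm z hz) (hzm x hx))]
    · exact absurd ⟨z, hz⟩ hj
  · rintro rfl
    exact ⟨x, rfl, i, .inl rfl, hx, hxm⟩

open Classical in
/-- A room in which some colour is missing has an even number of doors: none, or the two obtained
by removing one of the two points that share a colour. -/
lemma even_card_doors {c : X → I} {i₀ : I} {E : Finset X} (hE : E ∈ rooms r)
    (hc : E.image c ≠ Finset.univ) : Even ((doors r c i₀).filter (· ⊆ E)).card := by
  obtain ⟨hEcard, hEdom⟩ := mem_rooms.1 hE
  rcases ((doors r c i₀).filter (· ⊆ E)).eq_empty_or_nonempty with h0 | ⟨F, hF⟩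
  · simp [h0]
  obtain ⟨hF, hFE⟩ := Finset.mem_filter.1 hF
  obtain ⟨hFcard, hFdom, hFc⟩ := mem_doors.1 hF
  obtain ⟨x, hx, rfl⟩ := (Finset.covBy_iff_exists_insert (s := F) (t := E)).1
    (Finset.covBy_iff_card_sdiff_eq_one.2 ⟨hFE, by
      rw [Finset.card_sdiff_of_subset hFE]; omega⟩)
  have hinj : Set.InjOn c F := Finset.card_image_iff.1 (by
    rw [hFc, Finset.card_erase_of_mem (Finset.mem_univ _), Finset.card_univ]; omega)
  have hxc : c x ≠ i₀ := by
    intro e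
    apply hc
    rw [Finset.image_insert, hFc, e, Finset.insert_erase (Finset.mem_univ _)]
  obtain ⟨y, hyF, hyc⟩ : ∃ y ∈ F, c y = c x := by
    have : c x ∈ F.image c := by rw [hFc]; simpa using hxc
    simpa using this
  have hxy : x ≠ y := fun e => hx (e ▸ hyF)
  suffices (doors r c i₀).filter (· ⊆ insert x F) = {F, insert x (F.erase y)} by
    rw [this, Finset.card_pair]
    · exact even_two
    · intro e
      exact hx (e ▸ Finset.mem_insert_self x _)
  ext G
  rw [Finset.mem_filter, Finset.mem_insert, Finset.mem_singleton, mem_doors]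
  constructor
  · rintro ⟨⟨hG, -, hGc⟩, hGE⟩
    by_cases hxG : x ∈ G
    · right
      have hyG : y ∉ G := by
        intro hyG
        have hGinj : Set.InjOn c G := Finset.card_image_iff.1 (by
          rw [hGc, Finset.card_erase_of_mem (Finset.mem_univ _), Finset.card_univ]; omega)
        exact hxy (hGinj hxG hyG hyc.symm)
      apply Finset.eq_of_subset_of_card_le
      · intro z hz
        rcases Finset.mem_insert.1 (hGE hz) with rfl | hzF
        · exact Finset.mem_insert_self _ _
        · exact Finset.mem_insert_of_mem
            (Finset.mem_erase.2 ⟨fun e => hyG (e ▸ hz), hzF⟩)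
      · rw [Finset.card_insert_of_notMem (fun h => hx (Finset.mem_of_mem_erase h)),
          Finset.card_erase_of_mem hyF]
        have := Finset.card_pos.2 ⟨y, hyF⟩
        omega
    · left
      apply Finset.eq_of_subset_of_card_le
      · intro z hz
        exact (Finset.mem_insert.1 (hGE hz)).resolve_left fun e => hxG (e ▸ hz)
      · omega
  · rintro (rfl | rfl)
    · exact ⟨⟨hFcard, hFdom, hFc⟩, hFE⟩
    · have hsub : insert x (F.erase y) ⊆ insert x F :=
        Finset.insert_subset_insert _ (Finset.erase_subset _ _)
      refine ⟨⟨?_, hEdom.mono hsub, ?_⟩, hsub⟩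
      · rw [Finset.card_insert_of_notMem (fun h => hx (Finset.mem_of_mem_erase h)),
          Finset.card_erase_of_mem hyF]
        have := Finset.card_pos.2 ⟨y, hyF⟩
        omega
      · rw [Finset.image_insert, ← hyc, ← Finset.image_insert, Finset.insert_erase hyF, hFc]

/-- **Scarf's lemma.** The points `s i` are slack points: `s i` is ranked lowest by `r i` and
above all ordinary points by the other rankings. If `s i` has colour `i`, then some dominant set
carries all colours. -/
theorem exists_dominant_colorful [Nontrivial I] (hr : ∀ i, Function.Injective (r i)) (s : I → X)
    (hlow : ∀ i x, r i (s i) ≤ r i x)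
    (hhigh : ∀ i j x, x ∉ Set.range s → j ≠ i → r i x < r i (s j))
    (c : X → I) (hcs : ∀ i, c (s i) = i) :
    ∃ e : I → X, (∀ i, c (e i) = i) ∧ ∀ y, ∃ i, ∀ j, r i y ≤ r i (e j) := by
  classical
  suffices ∃ E ∈ rooms r, E.image c = Finset.univ by
    obtain ⟨E, hE, hEc⟩ := this
    have : ∀ i, ∃ x ∈ E, c x = i := fun i => by
      have : i ∈ E.image c := hEc ▸ Finset.mem_univ i
      simpa using this
    choose e he hc using this
    exact ⟨e, hc, fun y => ((mem_rooms.1 hE).2 y).imp fun i hi j => hi _ (he j)⟩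
  by_contra! hno
  obtain ⟨i₀, -⟩ := exists_pair_ne I
  have hs : Function.Injective s := Function.LeftInverse.injective hcs
  -- Count the pairs of a door contained in a room modulo two. Without a room of all colours the
  -- number is even room by room; but all doors lie in two rooms except for one, which lies in one.
  have hcount := Finset.sum_card_bipartiteAbove_eq_sum_card_bipartiteBelow
    (s := doors r c i₀) (t := rooms r) (fun F E => F ⊆ E)
  have heven : Even (∑ E ∈ rooms r, ((doors r c i₀).bipartiteBelow (fun F E => F ⊆ E) E).card) :=
    Finset.even_sum _ fun E hE => even_card_doors hE (hno E hE)
  rw [← hcount] at heven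
  -- The only door that lies in a single room is the set of all slack points except `s i₀`.
  set F₀ := (Finset.univ.erase i₀).image s with hF₀
  have hcard0 : F₀.card + 1 = Fintype.card I := by
    rw [hF₀, Finset.card_image_of_injective _ hs, Finset.card_erase_of_mem (Finset.mem_univ _),
      Finset.card_univ]
    have := Fintype.card_pos_iff.2 ⟨i₀⟩
    omega
  have hmem0 : ∀ l, l ≠ i₀ → s l ∈ F₀ := fun l hl =>
    Finset.mem_image_of_mem s (by simpa using hl)
  have hdom0 : Dominant r F₀ := by
    intro y
    by_cases hy : y ∈ Set.range s
    · obtain ⟨l, rfl⟩ := hy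
      exact ⟨l, fun x _ => hlow l x⟩
    · refine ⟨i₀, fun x hx => ?_⟩
      obtain ⟨l, hl, rfl⟩ := Finset.mem_image.1 hx
      exact (hhigh i₀ l y hy (Finset.ne_of_mem_erase hl)).le
  have hdoor0 : F₀ ∈ doors r c i₀ := by
    refine mem_doors.2 ⟨hcard0, hdom0, ?_⟩
    rw [hF₀, Finset.image_image]
    have : c ∘ s = id := funext hcs
    rw [this, Finset.image_id]
  have hone : ((doors r c i₀).filter fun F => F ⊆ F₀).card = 1 ∧
      ((rooms r).bipartiteAbove (fun F E => F ⊆ E) F₀).card = 1 := by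
    refine ⟨?_, ?_⟩
    · refine Finset.card_eq_one.2 ⟨F₀, ?_⟩
      ext F
      rw [Finset.mem_filter, Finset.mem_singleton]
      constructor
      · rintro ⟨hF, hsub⟩
        have := (mem_doors.1 hF).1
        exact Finset.eq_of_subset_of_card_le hsub (by omega)
      · rintro rfl
        exact ⟨hdoor0, subset_rfl⟩
    · obtain ⟨k, hk⟩ := exists_ne i₀
      obtain ⟨p, hp⟩ := exists_isMinSelection r ⟨s k, hmem0 k hk⟩
      have hps : ∀ l, l ≠ i₀ → p l = s l := fun l hl =>
        hr l (le_antisymm ((hp l).2 _ (hmem0 l hl)) (hlow l _))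
      obtain ⟨j, hj, hjp⟩ := Finset.mem_image.1 (hp i₀).1
      have hji := Finset.ne_of_mem_erase hj
      refine hp.card_rooms_eq_one hr hdom0 hcard0 hji.symm (by rw [← hjp, hps j hji]) ?_ ?_
      · refine ⟨s i₀, fun l hl => ?_⟩
        rw [hps l hl]
        exact lt_of_le_of_ne (hlow l _) fun e => hl (hs (hr l e))
      · rintro ⟨y, hy⟩
        have h0 := hy i₀ hji.symm
        rw [← hjp] at h0
        by_cases hys : y ∈ Set.range s
        · obtain ⟨m, rfl⟩ := hys
          by_cases hm0 : m = i₀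
          · subst hm0
            exact absurd (hlow m (s j)) (not_le.2 h0)
          · by_cases hmj : m = j
            · subst hmj
              exact lt_irrefl _ h0
            · have := hy m hmj
              rw [hps m hm0] at this
              exact lt_irrefl _ this
        · exact lt_asymm h0 (hhigh i₀ j y hys hji)
  have htwo : ∀ F ∈ (doors r c i₀).erase F₀,
      ((rooms r).bipartiteAbove (fun F E => F ⊆ E) F).card = 2 := by
    intro F hF
    obtain ⟨hne, hF⟩ := Finset.mem_erase.1 hF
    obtain ⟨hcard, hdom, hFc⟩ := mem_doors.1 hF
    have hFne : F.Nonempty := by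
      rw [← Finset.card_pos]
      have := Fintype.one_lt_card (α := I)
      omega
    obtain ⟨x, hxF, hxs⟩ : ∃ x ∈ F, x ∉ Set.range s := by
      by_contra! hall
      refine hne (Finset.eq_of_subset_of_card_le (fun x hx => ?_) (by omega))
      obtain ⟨l, rfl⟩ := hall x hx
      have : c (s l) ∈ F.image c := Finset.mem_image_of_mem c hx
      rw [hFc, hcs] at this
      exact Finset.mem_image_of_mem s this
    obtain ⟨p, hp⟩ := exists_isMinSelection r hFne
    obtain ⟨i, j, hij, h⟩ := hp.exists_collision hcard
    have hne : ∀ k, (Above r p k).Nonempty := fun k =>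
      ⟨s k, fun l hl => ((hp l).2 x hxF).trans_lt (hhigh l k x hxs hl.symm)⟩
    exact hp.card_rooms_eq_two hr hdom hcard hij h (hne i) (hne j)
  rw [← Finset.add_sum_erase _ _ hdoor0, hone.2, Finset.sum_congr rfl htwo, Finset.sum_const,
    smul_eq_mul] at heven
  grind

end Scarf

/-! ### A fixed-point theorem on the simplex -/

/-- For a colouring of the grid of points with sum `m`, there is a grid point `x` near which every
colour occurs, except for colours `i` whose coordinate `x i` is small. -/
lemma exists_grid_point {I : Type*} [Fintype I] [Nontrivial I] (m : ℕ) (c : (I → ℕ) → I) :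
    ∃ x : I → ℕ, ∑ i, x i = m ∧ ∀ i, x i ≤ Fintype.card I ∨
      ∃ x' : I → ℕ, ∑ k, x' k = m ∧ c x' = i ∧
        ∀ k, x k ≤ x' k + Fintype.card I ∧ x' k ≤ x k + Fintype.card I := by
  classical
  let T := {x : I → ℕ // x ∈ Finset.piAntidiag Finset.univ m}
  have hT : ∀ x : I → ℕ, x ∈ Finset.piAntidiag Finset.univ m ↔ ∑ i, x i = m := by
    simp [Finset.mem_piAntidiag]
  let X := T ⊕ I
  let _ : Fintype T := inferInstanceAs (Fintype (Finset.piAntidiag (Finset.univ : Finset I) m))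
  let _ : Fintype X := inferInstanceAs (Fintype (T ⊕ I))
  -- Rank by the coordinate `i`, with the slack point `i` below and the other slack points above
  -- all grid points; ties are broken by a fixed enumeration of all points.
  let level : I → X → ℕ := fun i =>
    Sum.elim (fun x => x.1 i + 1) fun k => if k = i then 0 else m + 2
  let K := Fintype.card X
  let idx : X → ℕ := fun x => (Fintype.equivFin X x : ℕ)
  have hidx : ∀ x, idx x < K := fun x => (Fintype.equivFin X x).2
  let r : I → X → ℕ := fun i x => level i x * K + idx x
  have hlt : ∀ i x y, level i x < level i y → r i x < r i y := by
    intro i x y h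
    have := hidx x
    have : (level i x + 1) * K ≤ level i y * K := Nat.mul_le_mul_right _ h
    simp only [r]
    linarith
  have hle : ∀ i x y, r i x ≤ r i y → level i x ≤ level i y := by
    intro i x y h
    by_contra! h'
    exact absurd (hlt i y x h') (not_lt.2 h)
  have hr : ∀ i, Function.Injective (r i) := by
    intro i x y h
    have hl : level i x = level i y := le_antisymm (hle i x y h.le) (hle i y x h.ge)
    have : idx x = idx y := by simpa [r, hl] using h
    exact (Fintype.equivFin X).injective (Fin.ext this)
  have hTle : ∀ (x : T) i, x.1 i ≤ m := fun x i =>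
    (Finset.single_le_sum (fun _ _ => Nat.zero_le _) (Finset.mem_univ i)).trans_eq ((hT _).1 x.2)
  obtain ⟨e, hec, hdom⟩ := exists_dominant_colorful hr (fun i => (Sum.inr i : X))
    (fun i x => by
      rcases x with x | k
      · exact (hlt _ _ _ (by simp [level])).le
      · by_cases hk : k = i
        · rw [hk]
        · exact (hlt _ _ _ (by simp [level, hk])).le)
    (fun i j x hx hji => by
      rcases x with x | k
      · have := hTle x i
        exact hlt _ _ _ (by simp [level, hji]; omega)
      · exact absurd ⟨k, rfl⟩ hx)
    (Sum.elim (fun x => c x.1) id) (fun _ => rfl)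
  -- `C` is the set of colours represented by a grid point; the others are represented by slacks.
  let C : Finset I := {i | (e i).isLeft}
  have hC : ∀ i ∈ C, ∃ x : T, e i = Sum.inl x := by
    intro i hi
    exact Sum.isLeft_iff.1 (by simpa [C] using hi)
  have hnC : ∀ i, i ∉ C → e i = Sum.inr i := by
    intro i hi
    rcases h : e i with x | k
    · simp [C, h] at hi
    · have := hec i
      rw [h] at this
      rw [← this]; rfl
  have hdomT : ∀ y : T, ∃ i ∈ C, ∀ j x, e j = Sum.inl x → y.1 i ≤ x.1 i := by
    intro y
    obtain ⟨i, hi⟩ := hdom (Sum.inl y)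
    have hiC : i ∈ C := by
      by_contra hiC
      have := hle _ _ _ (hi i)
      rw [hnC i hiC] at this
      simp [level] at this
    refine ⟨i, hiC, fun j x hx => ?_⟩
    have := hle _ _ _ (hi j)
    rw [hx] at this
    simpa [level] using this
  obtain ⟨i₀, -⟩ := exists_pair_ne I
  let y₀ : T := ⟨Pi.single i₀ m, (hT _).2 (by simp)⟩
  obtain ⟨k₀, hk₀, -⟩ := hdomT y₀
  have : Nonempty T := ⟨y₀⟩
  choose! d hd using hC
  have hCne : C.Nonempty := ⟨k₀, hk₀⟩
  -- `μ i` is the least `i`-th coordinate among the grid points of the dominant set.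
  let μ : I → ℕ := fun i => C.inf' hCne fun j => (d j).1 i
  have hμ : ∀ i, ∀ j ∈ C, μ i ≤ (d j).1 i := fun i j hj => Finset.inf'_le _ hj
  have hsum : m < ∑ i ∈ C, (μ i + 1) := by
    by_contra! hsum
    -- Otherwise some grid point exceeds `μ i` for all `i ∈ C`, against dominance.
    let y : I → ℕ := fun i => (if i ∈ C then μ i + 1 else 0) +
      (if i = k₀ then m - ∑ i ∈ C, (μ i + 1) else 0)
    have hy : ∑ i, y i = m := by
      simp only [y, Finset.sum_add_distrib, Finset.sum_ite_mem, Finset.univ_inter,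
        Finset.sum_ite_eq', Finset.mem_univ, if_true]
      simp only [Finset.sum_add_distrib] at hsum
      omega
    obtain ⟨i, hi, h⟩ := hdomT ⟨y, (hT y).2 hy⟩
    obtain ⟨j, hj, hjμ⟩ := C.exists_mem_eq_inf' hCne fun j => (d j).1 i
    have h1 := h j (d j) (hd j hj)
    have h2 : μ i = (d j).1 i := hjμ
    simp only [y, hi, if_true] at h1
    omega
  have hcardC : C.card ≤ Fintype.card I := Finset.card_le_univ _
  have hup : ∀ i ∈ C, ∀ k, (d i).1 k ≤ (if k ∈ C then μ k else 0) + Fintype.card I := by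
    intro i hi k
    have h1 := (hT _).1 (d i).2
    have h3 : ∑ k, ((d i).1 k - (if k ∈ C then μ k else 0)) + ∑ k, ((if k ∈ C then μ k else 0))
        = m := by
      rw [← Finset.sum_add_distrib]
      refine (Finset.sum_congr rfl fun k _ => ?_).trans h1
      split_ifs
      · exact Nat.sub_add_cancel (hμ k i hi)
      · rfl
    have h4 : (d i).1 k - (if k ∈ C then μ k else 0) ≤
        ∑ k, ((d i).1 k - (if k ∈ C then μ k else 0)) :=
      Finset.single_le_sum (f := fun k => (d i).1 k - (if k ∈ C then μ k else 0))
        (fun _ _ => Nat.zero_le _) (Finset.mem_univ k)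
    rw [Finset.sum_ite_mem, Finset.univ_inter] at h3
    rw [Finset.sum_add_distrib, Finset.sum_const, smul_eq_mul, mul_one] at hsum
    omega
  have hlow : ∀ i ∈ C, ∀ k, (if k ∈ C then μ k else 0) ≤ (d i).1 k := by
    intro i hi k
    split_ifs
    · exact hμ k i hi
    · exact Nat.zero_le _
  refine ⟨(d k₀).1, (hT _).1 (d k₀).2, fun i => ?_⟩
  by_cases hi : i ∈ C
  · refine .inr ⟨(d i).1, (hT _).1 (d i).2, ?_, fun k => ?_⟩
    · have := hec i
      rwa [hd i hi] at this
    · exact ⟨(hup k₀ hk₀ k).trans (Nat.add_le_add_right (hlow i hi k) _),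
        (hup i hi k).trans (Nat.add_le_add_right (hlow k₀ hk₀ k) _)⟩
  · refine .inl ?_
    simpa [hi] using hup k₀ hk₀ i

open Filter Topology

/-- A rescaling of `exists_grid_point` to the simplex. -/
lemma exists_simplex_point {I : Type*} [Fintype I] [Nontrivial I] (y : (I → ℝ) → I → ℝ) (m : ℕ) :
    ∃ x ∈ stdSimplex ℝ I, ∀ i, ∃ x' ∈ stdSimplex ℝ I,
      dist x' x ≤ Fintype.card I / ((m : ℝ) + 1) ∧
      (x i ≤ Fintype.card I / ((m : ℝ) + 1) ∨ ∀ j, y x' j ≤ y x' i) := by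
  have hm : (0 : ℝ) < (m : ℝ) + 1 := by positivity
  let t : (I → ℕ) → I → ℝ := fun x i => x i / ((m : ℝ) + 1)
  have ht : ∀ x : I → ℕ, ∑ i, x i = m + 1 → t x ∈ stdSimplex ℝ I := by
    intro x hx
    refine ⟨fun i => by positivity, ?_⟩
    simp only [t]
    rw [← Finset.sum_div, ← Nat.cast_sum, hx]
    push_cast
    exact div_self hm.ne'
  choose c hc using fun x : I → ℝ => Finite.exists_max (y x)
  obtain ⟨x, hx, h⟩ := exists_grid_point (m + 1) fun x => c (t x)
  refine ⟨t x, ht x hx, fun i => ?_⟩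
  rcases h i with h | ⟨x', hx', hci, hd⟩
  · refine ⟨t x, ht x hx, by rw [dist_self]; positivity, .inl ?_⟩
    simp only [t]
    gcongr
  · refine ⟨t x', ht x' hx', ?_, .inr fun j => by rw [← hci]; exact hc _ j⟩
    refine (dist_pi_le_iff (by positivity)).2 fun k => ?_
    have h1 : (x k : ℝ) ≤ x' k + Fintype.card I := by exact_mod_cast (hd k).1
    have h2 : (x' k : ℝ) ≤ x k + Fintype.card I := by exact_mod_cast (hd k).2
    simp only [t]
    rw [Real.dist_eq, ← sub_div, abs_div, abs_of_pos hm]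
    gcongr
    rw [abs_le]
    constructor <;> linarith

/-- A continuous vector field `y` on the simplex has a point `x` all of whose weight is on
coordinates at which `y x` is maximal. This is equivalent to Brouwer's fixed-point theorem. -/
theorem exists_support_subset_argmax {I : Type*} [Fintype I] [Nonempty I] (y : (I → ℝ) → I → ℝ)
    (hy : ContinuousOn y (stdSimplex ℝ I)) :
    ∃ x ∈ stdSimplex ℝ I, ∀ i, 0 < x i → ∀ j, y x j ≤ y x i := by
  rcases subsingleton_or_nontrivial I with hI | hI
  · obtain ⟨i₀⟩ := ‹Nonempty I›
    classical
    exact ⟨Pi.single i₀ 1, single_mem_stdSimplex ℝ i₀, fun i _ j => by rw [Subsingleton.elim j i]⟩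
  choose x hx x' hx' hd h using exists_simplex_point y
  obtain ⟨z, hz, φ, hφ, hlim⟩ := (isCompact_stdSimplex ℝ I).tendsto_subseq hx
  have hsmall : Tendsto (fun m : ℕ => (Fintype.card I : ℝ) / ((φ m : ℕ) + 1 : ℝ)) atTop (𝓝 0) :=
    ((tendsto_const_div_atTop_nhds_zero_nat (Fintype.card I : ℝ)).comp
      ((tendsto_add_atTop_nat 1).comp hφ.tendsto_atTop)).congr fun m => by simp
  refine ⟨z, hz, fun i hi j => ?_⟩
  have hlim' : Tendsto (fun m => x' (φ m) i) atTop (𝓝 z) :=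
    hlim.congr_dist (squeeze_zero (fun _ => dist_nonneg)
      (fun m => by rw [dist_comm]; exact hd (φ m) i) hsmall)
  have hylim : Tendsto (fun m => y (x' (φ m) i)) atTop (𝓝 (y z)) :=
    (hy z hz).tendsto.comp
      (tendsto_nhdsWithin_iff.2 ⟨hlim', Eventually.of_forall fun m => hx' (φ m) i⟩)
  have hxi : Tendsto (fun m => x (φ m) i) atTop (𝓝 (z i)) := (tendsto_pi_nhds.1 hlim) i
  refine le_of_tendsto_of_tendsto (tendsto_pi_nhds.1 hylim j) (tendsto_pi_nhds.1 hylim i) ?_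
  filter_upwards [hsmall.eventually_lt hxi hi] with m hm
  exact ((h (φ m) i).resolve_left (not_le.2 hm)) j

/-! ### Equilibria of bimatrix games -/

/-- Every bimatrix game has an approximate equilibrium in which one player replies exactly and the
other only uses actions within `ε` of the best one. -/
lemma exists_approx_equilibrium {S A : Type*} [Fintype S] [Nonempty S] [Fintype A] [Nonempty A]
    (G V : S → A → ℝ) {ε : ℝ} (hε : 0 < ε) :
    ∃ x ∈ stdSimplex ℝ S, ∃ α ∈ stdSimplex ℝ A,
      (∀ a, 0 < α a → ∀ b, ∑ s, x s * V s b ≤ ∑ s, x s * V s a + ε) ∧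
      ∀ s, 0 < x s → ∀ t, ∑ a, α a * G t a ≤ ∑ a, α a * G s a := by
  let P : (S → ℝ) → A → ℝ := fun x a => ∑ s, x s * V s a
  have hP : ∀ a, Continuous fun x => P x a := fun a => by fun_prop
  let M : (S → ℝ) → ℝ := fun x => Finset.univ.sup' Finset.univ_nonempty (P x)
  have hM : Continuous M := Continuous.finset_sup'_apply _ fun a _ => hP a
  have hMle : ∀ x a, P x a ≤ M x := fun x a => Finset.le_sup' (P x) (Finset.mem_univ a)
  -- Weights proportional to the slack in the constraint of being within `ε` of the maximum.
  let w : (S → ℝ) → A → ℝ := fun x a => max 0 (P x a - M x + ε)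
  have hw0 : ∀ x a, 0 ≤ w x a := fun x a => le_max_left _ _
  have hwc : ∀ a, Continuous fun x => w x a := fun a =>
    continuous_const.max (((hP a).sub hM).add continuous_const)
  have hW : ∀ x, 0 < ∑ a, w x a := by
    intro x
    obtain ⟨a, -, ha⟩ := Finset.exists_mem_eq_sup' Finset.univ_nonempty (P x)
    refine Finset.sum_pos' (fun a _ => hw0 x a) ⟨a, Finset.mem_univ a, lt_max_of_lt_right ?_⟩
    have : M x = P x a := ha
    linarith
  let β : (S → ℝ) → A → ℝ := fun x a => w x a / ∑ b, w x b
  have hβc : ∀ a, Continuous fun x => β x a := fun a =>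
    (hwc a).div (continuous_finsetSum _ fun b _ => hwc b) fun x => (hW x).ne'
  obtain ⟨x, hx, h⟩ := exists_support_subset_argmax (fun x s => ∑ a, β x a * G s a)
    (Continuous.continuousOn (continuous_pi fun s =>
      continuous_finsetSum _ fun a _ => (hβc a).mul continuous_const))
  refine ⟨x, hx, β x, ⟨fun a => div_nonneg (hw0 x a) (hW x).le, ?_⟩, fun a ha b => ?_, h⟩
  · simp only [β]
    rw [← Finset.sum_div, div_self (hW x).ne']
  · have hwa : 0 < w x a := by
      by_contra hwa
      have : w x a = 0 := le_antisymm (not_lt.1 hwa) (hw0 x a)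
      simp [β, this] at ha
    have h1 : 0 < P x a - M x + ε := (lt_max_iff.1 hwa).resolve_left (lt_irrefl _)
    have h2 := hMle x b
    change P x b ≤ P x a + ε
    linarith

/-- **Nash's theorem** for two players: in the bimatrix game with payoffs `G` and `V` there are
mixed actions `x` and `α` that only use best replies to each other. -/
theorem exists_equilibrium {S A : Type*} [Fintype S] [Nonempty S] [Fintype A] [Nonempty A]
    (G V : S → A → ℝ) :
    ∃ x ∈ stdSimplex ℝ S, ∃ α ∈ stdSimplex ℝ A,
      (∀ a, 0 < α a → ∀ b, ∑ s, x s * V s b ≤ ∑ s, x s * V s a) ∧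
      ∀ s, 0 < x s → ∀ t, ∑ a, α a * G t a ≤ ∑ a, α a * G s a := by
  choose x hx α hα hV hG using fun n : ℕ =>
    exists_approx_equilibrium G V (ε := 1 / ((n : ℝ) + 1)) (by positivity)
  obtain ⟨⟨z, γ⟩, ⟨hz, hγ⟩, φ, hφ, hlim⟩ :=
    ((isCompact_stdSimplex ℝ S).prod (isCompact_stdSimplex ℝ A)).tendsto_subseq
      (x := fun n => (x n, α n)) fun n => ⟨hx n, hα n⟩
  obtain ⟨hxl, hαl⟩ := Prod.tendsto_iff _ _ |>.1 hlim
  have hxs : ∀ s, Tendsto (fun n => x (φ n) s) atTop (𝓝 (z s)) := tendsto_pi_nhds.1 hxl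
  have hαa : ∀ a, Tendsto (fun n => α (φ n) a) atTop (𝓝 (γ a)) := tendsto_pi_nhds.1 hαl
  have hVl : ∀ a, Tendsto (fun n => ∑ s, x (φ n) s * V s a) atTop (𝓝 (∑ s, z s * V s a)) :=
    fun a => tendsto_finsetSum _ fun s _ => (hxs s).mul_const _
  have hGl : ∀ s, Tendsto (fun n => ∑ a, α (φ n) a * G s a) atTop (𝓝 (∑ a, γ a * G s a)) :=
    fun s => tendsto_finsetSum _ fun a _ => (hαa a).mul_const _
  have hε : Tendsto (fun n => 1 / ((φ n : ℝ) + 1)) atTop (𝓝 0) :=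
    tendsto_one_div_add_atTop_nhds_zero_nat.comp hφ.tendsto_atTop
  refine ⟨z, hz, γ, hγ, fun a ha b => ?_, fun s hs t => ?_⟩
  · have := (hVl a).add hε
    rw [add_zero] at this
    refine le_of_tendsto_of_tendsto (hVl b) this ?_
    filter_upwards [(hαa a).eventually (lt_mem_nhds ha)] with n hn
    exact hV (φ n) a hn b
  · refine le_of_tendsto_of_tendsto (hGl t) (hGl s) ?_
    filter_upwards [(hxs s).eventually (lt_mem_nhds hs)] with n hn
    exact hG (φ n) s hn t

/-! ### Payoffs and optimal splittings -/

section Payoff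

variable {A Ω S : Type*} [Fintype A] [Fintype Ω] [Fintype S]

lemma payoff_eq_sum_action (w : A → Ω → ℝ) (α : A → ℝ) (π : Ω → ℝ) :
    payoff w α π = ∑ a, α a * ∑ ω, π ω * w a ω := by
  simp only [payoff, Finset.mul_sum, mul_assoc]

lemma payoff_sum_smul (w : A → Ω → ℝ) (α : A → ℝ) (x : S → ℝ) (q : S → Ω → ℝ) :
    payoff w α (∑ s, x s • q s) = ∑ s, x s * payoff w α (q s) := by
  simp only [payoff, Finset.mul_sum, Finset.sum_apply, Pi.smul_apply, smul_eq_mul, Finset.sum_mul]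
  rw [Finset.sum_comm' (t' := Finset.univ) (s' := fun _ => Finset.univ) (by simp)]
  conv_rhs => rw [Finset.sum_comm, Finset.sum_congr rfl fun _ _ => Finset.sum_comm]
  rw [Finset.sum_comm]
  refine Finset.sum_congr rfl fun a _ => Finset.sum_congr rfl fun ω _ =>
    Finset.sum_congr rfl fun s _ => by ring

/-- A mixed action that only uses pure best replies is a best reply. -/
lemma mem_BR_of_support {v : A → Ω → ℝ} {α : A → ℝ} {π : Ω → ℝ} (hα : α ∈ stdSimplex ℝ A)
    (h : ∀ a, 0 < α a → ∀ b, ∑ ω, π ω * v b ω ≤ ∑ ω, π ω * v a ω) : α ∈ BR v π := by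
  refine ⟨hα, fun α' hα' => ?_⟩
  obtain ⟨a, -, ha⟩ : ∃ a ∈ Finset.univ, 0 < α a :=
    Finset.exists_lt_of_sum_lt (by simp [hα.2])
  have hle : ∀ b, ∑ ω, π ω * v b ω ≤ ∑ ω, π ω * v a ω := h a ha
  calc payoff v α' π ≤ ∑ b, α' b * ∑ ω, π ω * v a ω := by
        rw [payoff_eq_sum_action]
        exact Finset.sum_le_sum fun b _ => mul_le_mul_of_nonneg_left (hle b) (hα'.1 b)
    _ = ∑ b, α b * ∑ ω, π ω * v a ω := by
        rw [← Finset.sum_mul, ← Finset.sum_mul, hα'.2, hα.2]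
    _ ≤ payoff v α π := by
        rw [payoff_eq_sum_action]
        refine Finset.sum_le_sum fun b _ => ?_
        rcases (hα.1 b).eq_or_lt with hb | hb
        · rw [← hb, zero_mul, zero_mul]
        · exact mul_le_mul_of_nonneg_left (h b hb a) hb.le

lemma payoff_le {w : A → Ω → ℝ} {α : A → ℝ} {π : Ω → ℝ} (hα : α ∈ stdSimplex ℝ A)
    (hπ : π ∈ stdSimplex ℝ Ω) : payoff w α π ≤ ∑ a, ∑ ω, |w a ω| := by
  refine Finset.sum_le_sum fun a _ => Finset.sum_le_sum fun ω _ => ?_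
  have h1 := mem_Icc_of_mem_stdSimplex hα a
  have h2 := mem_Icc_of_mem_stdSimplex hπ ω
  calc α a * π ω * w a ω ≤ α a * π ω * |w a ω| :=
        mul_le_mul_of_nonneg_left (le_abs_self _) (mul_nonneg h1.1 h2.1)
    _ ≤ 1 * |w a ω| :=
        mul_le_mul_of_nonneg_right (mul_le_one₀ h1.2 h2.1 h2.2) (abs_nonneg _)
    _ = |w a ω| := one_mul _

lemma payoff_le_ubar {u v : A → Ω → ℝ} {α : A → ℝ} {π : Ω → ℝ} (hα : α ∈ BR v π)
    (hπ : π ∈ stdSimplex ℝ Ω) : payoff u α π ≤ ubar u v π := by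
  refine le_csSup ⟨∑ a, ∑ ω, |u a ω|, ?_⟩ ⟨α, hα, rfl⟩
  rintro _ ⟨β, hβ, rfl⟩
  exact payoff_le hβ.1 hπ

lemma ubar_le (u v : A → Ω → ℝ) {π : Ω → ℝ} (hπ : π ∈ stdSimplex ℝ Ω) :
    ubar u v π ≤ ∑ a, ∑ ω, |u a ω| := by
  refine Real.sSup_le ?_ (Finset.sum_nonneg fun a _ => Finset.sum_nonneg fun ω _ => abs_nonneg _)
  rintro _ ⟨β, hβ, rfl⟩
  exact payoff_le hβ.1 hπ

/-- On the convex hull of the posteriors of an optimal splitting, `ū` lies below the average of its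
values at the posteriors. Otherwise, as all the weights `l s` are positive, the average
`∑ s, x s • q s` could be split off from the prior with a small probability `ε`, at the expense of
the `q s`, and the expected payoff would exceed `cav ū`. -/
lemma IsOptimalSplitting.ubar_sum_le {u v : A → Ω → ℝ} {π₀ : Ω → ℝ} {l : S → ℝ}
    {q : S → Ω → ℝ} (h : IsOptimalSplitting u v π₀ l q) {x : S → ℝ} (hx : x ∈ stdSimplex ℝ S) :
    ubar u v (∑ s, x s • q s) ≤ ∑ s, x s * ubar u v (q s) := by
  obtain ⟨s₀, -, -⟩ : ∃ s ∈ Finset.univ, 0 < l s :=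
    Finset.exists_lt_of_sum_lt (by simp [h.weight_sum])
  have : Nonempty S := ⟨s₀⟩
  have hconv := convex_stdSimplex ℝ Ω
  have hmem : ∑ s, x s • q s ∈ stdSimplex ℝ Ω :=
    hconv.sum_mem (fun s _ => hx.1 s) hx.2 fun s _ => h.posterior_mem s
  obtain ⟨s₁, hs₁⟩ := Finite.exists_min l
  set ε := l s₁ with hε
  have hεpos : 0 < ε := h.weight_pos s₁
  have hle : ∀ s, 0 ≤ l s - ε * x s := fun s => by
    have := mul_le_of_le_one_right hεpos.le (mem_Icc_of_mem_stdSimplex hx s).2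
    linarith [hs₁ s]
  suffices ε * ubar u v (∑ s, x s • q s) + ∑ s, (l s - ε * x s) * ubar u v (q s) ≤
      ∑ s, l s * ubar u v (q s) by
    simp only [sub_mul, Finset.sum_sub_distrib, mul_assoc] at this
    rw [← Finset.mul_sum] at this
    exact le_of_mul_le_mul_left (by linarith) hεpos
  rw [h.optimal]
  refine le_csInf ⟨∑ a, ∑ ω, |u a ω|, fun _ => ∑ a, ∑ ω, |u a ω|,
    concaveOn_const _ hconv, fun p hp => ubar_le u v hp, rfl⟩ ?_
  rintro _ ⟨f, hf, hfu, rfl⟩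
  -- Jensen's inequality for the splitting with posteriors `∑ s, x s • q s` and `q s`, `s ∈ S`.
  let W : Option S → ℝ := fun o => o.elim ε fun s => l s - ε * x s
  let Q : Option S → Ω → ℝ := fun o => o.elim (∑ s, x s • q s) q
  have hQ : ∀ o, Q o ∈ stdSimplex ℝ Ω := by
    rintro (_ | s)
    exacts [hmem, h.posterior_mem s]
  have hW0 : ∀ o, 0 ≤ W o := by
    rintro (_ | s)
    exacts [hεpos.le, hle s]
  have hW1 : ∑ o, W o = 1 := by
    simp only [W, Fintype.sum_option, Option.elim, Finset.sum_sub_distrib, ← Finset.mul_sum,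
      h.weight_sum, hx.2]
    ring
  have hWQ : ∑ o, W o • Q o = π₀ := by
    simp only [W, Q, Fintype.sum_option, Option.elim, sub_smul, Finset.sum_sub_distrib, mul_smul,
      ← Finset.smul_sum, h.average]
    abel
  have hJ := hf.le_map_sum (t := Finset.univ) (w := W) (p := Q) (fun o _ => hW0 o) hW1
    fun o _ => hQ o
  rw [hWQ] at hJ
  refine le_trans ?_ hJ
  have : ∑ o, W o • ubar u v (Q o) ≤ ∑ o, W o • f (Q o) :=
    Finset.sum_le_sum fun o _ => mul_le_mul_of_nonneg_left (hfu _ (hQ o)) (hW0 o)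
  rw [Fintype.sum_option] at this
  exact this

end Payoff

end UniformPunishment

theorem lemma1 {A Ω S : Type*} [Fintype A] [Nonempty A] [Fintype Ω] [Fintype S]
    (u v : A → Ω → ℝ) (π₀ : Ω → ℝ) (hπ₀ : π₀ ∈ stdSimplex ℝ Ω)
    (l : S → ℝ) (q : S → Ω → ℝ)
    (hopt : UniformPunishment.IsOptimalSplitting u v π₀ l q) :
    ∃ πp ∈ convexHull ℝ (Set.range q), ∃ αp ∈ UniformPunishment.BR v πp,
      ∀ s, UniformPunishment.payoff u αp (q s) ≤ UniformPunishment.ubar u v (q s) := by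
  obtain ⟨s₀, -, -⟩ : ∃ s ∈ Finset.univ, 0 < l s :=
    Finset.exists_lt_of_sum_lt (by simp [hopt.weight_sum])
  have : Nonempty S := ⟨s₀⟩
  obtain ⟨x, hx, α, hα, hV, hG⟩ := UniformPunishment.exists_equilibrium
    (fun s a => ∑ ω, q s ω * u a ω - UniformPunishment.ubar u v (q s))
    (fun s a => ∑ ω, q s ω * v a ω)
  have hG' : ∀ t, ∑ a, α a * (∑ ω, q t ω * u a ω - UniformPunishment.ubar u v (q t)) =
      UniformPunishment.payoff u α (q t) - UniformPunishment.ubar u v (q t) := by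
    intro t
    simp only [mul_sub, Finset.sum_sub_distrib, ← Finset.sum_mul, hα.2, one_mul,
      UniformPunishment.payoff_eq_sum_action]
  simp only [hG'] at hG
  have hBR : α ∈ UniformPunishment.BR v (∑ s, x s • q s) := by
    refine UniformPunishment.mem_BR_of_support hα fun a ha b => ?_
    have hswap : ∀ c, ∑ ω, (∑ s, x s • q s) ω * v c ω = ∑ s, x s * ∑ ω, q s ω * v c ω := by
      intro c
      simp only [Finset.sum_apply, Pi.smul_apply, smul_eq_mul, Finset.sum_mul, Finset.mul_sum,
        mul_assoc]
      exact Finset.sum_comm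
    rw [hswap, hswap]
    exact hV a ha b
  refine ⟨∑ s, x s • q s, (convex_convexHull ℝ _).sum_mem (fun s _ => hx.1 s) hx.2
    fun s _ => subset_convexHull ℝ _ ⟨s, rfl⟩, α, hBR, fun t => ?_⟩
  -- The average of the gains `u(α, q s) - ū(q s)` under `x` is at most zero, hence so is their
  -- maximum, which `x` attains on its support.
  have hmem : ∑ s, x s • q s ∈ stdSimplex ℝ Ω :=
    (convex_stdSimplex ℝ Ω).sum_mem (fun s _ => hx.1 s) hx.2 fun s _ => hopt.posterior_mem s
  have h1 := (UniformPunishment.payoff_le_ubar (u := u) hBR hmem).trans (hopt.ubar_sum_le hx)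
  rw [UniformPunishment.payoff_sum_smul] at h1
  have h2 : ∑ s, x s * (UniformPunishment.payoff u α (q t) - UniformPunishment.ubar u v (q t)) ≤
      ∑ s, x s * (UniformPunishment.payoff u α (q s) - UniformPunishment.ubar u v (q s)) := by
    refine Finset.sum_le_sum fun s _ => ?_
    rcases (hx.1 s).eq_or_lt with hs | hs
    · rw [← hs, zero_mul, zero_mul]
    · exact mul_le_mul_of_nonneg_left (hG s hs t) hs.le
  rw [← Finset.sum_mul, hx.2, one_mul] at h2
  simp only [mul_sub, Finset.sum_sub_distrib] at h2
  linarith
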